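/- Let $\mathcal H_A,\mathcal H_B$ be finite-dimensional complex Hilbert spaces and $\mathcal H_{AB}=\mathcal H_A\otimes\mathcal H_B$. Let $\mathcal S_\le(\mathcal H)$ be the set of positive semidefinite operators $\rho$ on $\mathcal H$ with $\operatorname{tr}\rho\le 1$, and let $\log$ be the logarithm to base $2$, with $\log 0=-\infty$. For positive semidefinite $\rho,\sigma$ let $F(\rho,\sigma)=\|\sqrt\rho\sqrt\sigma\|_1$, where $\|R\|_1=\operatorname{tr}\sqrt{R^\dagger R}$, and for $\rho,\sigma\in\mathcal S_\le(\mathcal H)$ let $$P(\rho,\sigma)=\sqrt{1-\bar F(\rho,\sigma)^2},\qquad \bar F(\rho,\sigma)=F(\rho,\sigma)+\sqrt{(1-\operatorname{tr}\rho)(1-\operatorname{tr}\sigma)}$$ be the purified distance. For $\rho\in\mathcal S_\le(\mathcal H_{AB})$ define, with values in $[-\infty,\infty]$, $$H_{\min}(A|B)_\rho=\sup_{\sigma\in\mathcal S_\le(\mathcal H_B)}\sup\{\lambda\in\mathbb R:\rho\le 2^{-\lambda}\,1_A\otimes\sigma\},\qquad H_{\max}(A|B)_\rho=\sup_{\sigma\in\mathcal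 S_\le(\mathcal H_B)}\log F(\rho,1_A\otimes\sigma)^2,$$ and, for $\varepsilon\ge 0$, $$H_{\min}^{\varepsilon}(A|B)_\rho=\sup_{\tilde\rho}H_{\min}(A|B)_{\tilde\rho},\qquad H_{\max}^{\varepsilon}(A|B)_\rho=\inf_{\tilde\rho}H_{\max}(A|B)_{\tilde\rho},$$ where $\tilde\rho$ ranges over all elements of $\mathcal S_\le(\mathcal H_{AB})$ with $P(\tilde\rho,\rho)\le\varepsilon$. Let $\varepsilon,\varepsilon'\ge 0$ and let $\rho\in\mathcal S_\le(\mathcal H_{AB})$ be such that $\varepsilon+\varepsilon'+2\sqrt{1-\operatorname{tr}\rho}<1$. Then $$H_{\min}^{\varepsilon'}(A|B)_\rho\le H_{\max}^{\varepsilon}(A|B)_\rho+\log\frac{1}{1-\left(\varepsilon+\varepsilon'+2\sqrt{1-\operatorname{tr}\rho}\right)^2}.$$ -/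

import Mathlib

open scoped Kronecker ComplexOrder MatrixOrder

noncomputable section

namespace SmoothEntropy

variable {n A B : Type*} [Fintype n] [DecidableEq n] [Fintype A] [DecidableEq A]
  [Fintype B] [DecidableEq B]

/-- Sub-normalized density operators on the Hilbert space `ℂ^n`: `ρ ≥ 0` and `tr ρ ≤ 1`
(the trace of a positive semidefinite matrix is real). -/
def IsSubnormalized (ρ : Matrix n n ℂ) : Prop :=
  ρ.PosSemidef ∧ ρ.trace.re ≤ 1

/-- The trace norm `‖R‖₁ = tr √(R† R)`. -/
def traceNorm (R : Matrix n n ℂ) : ℝ :=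
  (CFC.sqrt (R.conjTranspose * R)).trace.re

/-- The fidelity `F(ρ, σ) = ‖√ρ √σ‖₁` of positive semidefinite operators. -/
def fidelity (ρ σ : Matrix n n ℂ) : ℝ :=
  traceNorm (CFC.sqrt ρ * CFC.sqrt σ)

/-- The generalized fidelity `F(ρ, σ) + √((1 - tr ρ)(1 - tr σ))` of sub-normalized states. -/
def genFidelity (ρ σ : Matrix n n ℂ) : ℝ :=
  fidelity ρ σ + √((1 - ρ.trace.re) * (1 - σ.trace.re))

/-- The purified distance of sub-normalized states. -/
def purifiedDist (ρ σ : Matrix n n ℂ) : ℝ :=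
  √(1 - genFidelity ρ σ ^ 2)

/-- The binary logarithm of a nonnegative real, with `log 0 = -∞`. -/
def elog2 (x : ℝ) : EReal :=
  if x ≤ 0 then ⊥ else (Real.logb 2 x : EReal)

/-- `sup {l ∈ ℝ : ρ_AB ≤ 2^(-l) (1_A ⊗ σ_B)}`, in the extended reals. -/
def minEntropyRel (ρ : Matrix (A × B) (A × B) ℂ) (σ : Matrix B B ℂ) : EReal :=
  ⨆ (l : ℝ) (_ : ((((2 : ℝ) ^ (-l) : ℝ) : ℂ) • ((1 : Matrix A A ℂ) ⊗ₖ σ) - ρ).PosSemidef),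
    (l : EReal)

/-- The conditional min-entropy `H_min(A|B)_ρ`. -/
def minEntropy (ρ : Matrix (A × B) (A × B) ℂ) : EReal :=
  ⨆ (σ : Matrix B B ℂ) (_ : IsSubnormalized σ), minEntropyRel ρ σ

/-- `log F(ρ_AB, 1_A ⊗ σ_B)²`. -/
def maxEntropyRel (ρ : Matrix (A × B) (A × B) ℂ) (σ : Matrix B B ℂ) : EReal :=
  elog2 (fidelity ρ ((1 : Matrix A A ℂ) ⊗ₖ σ) ^ 2)

/-- The conditional max-entropy `H_max(A|B)_ρ`. -/
def maxEntropy (ρ : Matrix (A × B) (A × B) ℂ) : EReal :=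
  ⨆ (σ : Matrix B B ℂ) (_ : IsSubnormalized σ), maxEntropyRel ρ σ

/-- The smooth min-entropy: optimization over all sub-normalized states that are
`ε`-close to `ρ` in purified distance. -/
def smoothMinEntropy (ε : ℝ) (ρ : Matrix (A × B) (A × B) ℂ) : EReal :=
  ⨆ (τ : Matrix (A × B) (A × B) ℂ) (_ : IsSubnormalized τ ∧ purifiedDist τ ρ ≤ ε),
    minEntropy τ

/-- The smooth max-entropy: optimization over all sub-normalized states that are
`ε`-close to `ρ` in purified distance. -/
def smoothMaxEntropy (ε : ℝ) (ρ : Matrix (A × B) (A × B) ℂ) : EReal :=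
  ⨅ (τ : Matrix (A × B) (A × B) ℂ) (_ : IsSubnormalized τ ∧ purifiedDist τ ρ ≤ ε),
    maxEntropy τ

end SmoothEntropy

end

noncomputable section

namespace SmoothEntropy

open Filter Topology

variable {n A B : Type*} [Fintype n] [DecidableEq n] [Fintype A] [DecidableEq A]
  [Fintype B] [DecidableEq B]

/-! ### Angles between unit vectors. -/

section Overlap

variable {E : Type*} [NormedAddCommGroup E] [InnerProductSpace ℝ E]

/-! Let `τ` and `τ'` compete in the smooth max- and min-entropy. If `τ' ≤ 2^(-l) (1 ⊗ σ)`,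
monotonicity and homogeneity of the squared fidelity give `F(τ,τ')² ≤ 2^(-l) F(τ, 1 ⊗ σ)²`, hence `l
+ log F(τ,τ')² ≤ H_max(τ)` (`coe_add_logb_fidelity_sq_le_maxEntropy`). It remains to bound `F(τ,τ')`
below (`sqrt_one_sub_fidelity_sq_le`). States become unit vectors: a square root times a unitary,
with the missing trace stored in one of two spare coordinates. Unitaries from polar decompositions
make the overlaps with `ρ` equal to generalized fidelities, and the sine of the angle obeys the
triangle inequality. Storing the deficits of `τ` and `τ'` in different coordinates leaves the plain
fidelity as a bound on their overlap; moving the deficit of `ρ` from one coordinate to the other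
costs the term `2 √(1 - tr ρ)`. -/

theorem norm_sub_smul_sq_of_norm_eq_one {x z : E} (hx : ‖x‖ = 1) (hz : ‖z‖ = 1) (t : ℝ) :
    ‖x - t • z‖ ^ 2 = 1 - 2 * t * inner ℝ x z + t ^ 2 := by
  rw [norm_sub_sq_real, norm_smul, hx, hz, inner_smul_right, Real.norm_eq_abs, mul_one, sq_abs]
  ring

theorem sqrt_one_sub_inner_sq_eq_norm {x y : E} (hx : ‖x‖ = 1) (hy : ‖y‖ = 1) :
    √(1 - inner ℝ x y ^ 2) = ‖x - (inner ℝ x y : ℝ) • y‖ := by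
  rw [← Real.sqrt_sq (norm_nonneg (x - _)), norm_sub_smul_sq_of_norm_eq_one hx hy]
  congr 1
  ring

/-- The sine of the angle between lines satisfies the triangle inequality. -/
theorem sqrt_one_sub_inner_sq_triangle {x y z : E} (hx : ‖x‖ = 1) (hy : ‖y‖ = 1) (hz : ‖z‖ = 1) :
    √(1 - inner ℝ x z ^ 2) ≤ √(1 - inner ℝ x y ^ 2) + √(1 - inner ℝ y z ^ 2) := by
  set a : ℝ := inner ℝ x y with ha
  set b : ℝ := inner ℝ y z with hb
  have hxy : √(1 - a ^ 2) = ‖x - a • y‖ := sqrt_one_sub_inner_sq_eq_norm hx hy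
  have hyz : √(1 - b ^ 2) = ‖y - b • z‖ := sqrt_one_sub_inner_sq_eq_norm hy hz
  have ha1 : |a| ≤ 1 := by simpa [hx, hy] using abs_real_inner_le_norm x y
  -- The left side is the distance from `x` to the line through `z`, so any multiple of `z` gives an
  -- upper bound.
  have hle : √(1 - inner ℝ x z ^ 2) ≤ ‖x - (a * b) • z‖ := by
    rw [← Real.sqrt_sq (norm_nonneg (x - _)), norm_sub_smul_sq_of_norm_eq_one hx hz]
    apply Real.sqrt_le_sqrt
    nlinarith [sq_nonneg (inner ℝ x z - a * b)]
  rw [hxy, hyz]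
  have hdecomp : x - (a * b) • z = (x - a • y) + a • (y - b • z) := by
    rw [smul_sub, mul_smul]; abel
  refine hle.trans ?_
  rw [hdecomp]
  refine (norm_add_le _ _).trans ?_
  rw [norm_smul, Real.norm_eq_abs]
  gcongr
  exact mul_le_of_le_one_left (norm_nonneg _) ha1

end Overlap

/-! ### Polar decomposition and operator square roots. -/

section Polar

theorem isCompact_unitaryGroup : IsCompact (Matrix.unitaryGroup n ℂ : Set (Matrix n n ℂ)) := by
  have hcl : IsClosed (Matrix.unitaryGroup n ℂ : Set (Matrix n n ℂ)) := by
    have : (Matrix.unitaryGroup n ℂ : Set (Matrix n n ℂ)) =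
        (fun U => U * star U) ⁻¹' {1} := by
      ext U
      simp [Matrix.mem_unitaryGroup_iff]
    rw [this]
    refine isClosed_singleton.preimage ?_
    fun_prop
  refine IsCompact.of_isClosed_subset (isCompact_univ_pi fun _ : n => isCompact_univ_pi
    fun _ : n => isCompact_closedBall (0 : ℂ) 1) hcl ?_
  intro U hU
  exact fun i _ j _ => by simpa using entry_norm_bound_of_unitary hU i j

open scoped Matrix.Norms.L2Operator in
theorem isClosed_setOf_posSemidef : IsClosed {X : Matrix n n ℂ | X.PosSemidef} := by
  simpa [Matrix.nonneg_iff_posSemidef] using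
    CStarAlgebra.isClosed_nonneg (A := Matrix n n ℂ)

open scoped Matrix.Norms.L2Operator in
theorem sqrt_monotone : Monotone (CFC.sqrt : Matrix n n ℂ → Matrix n n ℂ) :=
  CFC.monotone_sqrt

theorem sqrt_posSemidef (X : Matrix n n ℂ) : (CFC.sqrt X).PosSemidef :=
  Matrix.nonneg_iff_posSemidef.1 (CFC.sqrt_nonneg X)

theorem sqrt_mul_sqrt {X : Matrix n n ℂ} (hX : X.PosSemidef) : CFC.sqrt X * CFC.sqrt X = X :=
  CFC.sqrt_mul_sqrt_self X (Matrix.nonneg_iff_posSemidef.2 hX)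

theorem exists_unitary_mul_posSemidef_of_isUnit {R : Matrix n n ℂ} (hR : IsUnit R.det) :
    ∃ U ∈ Matrix.unitaryGroup n ℂ, (U * R).PosSemidef := by
  set P := CFC.sqrt (R.conjTranspose * R) with hP
  have hPP : P * P = R.conjTranspose * R := sqrt_mul_sqrt (Matrix.posSemidef_conjTranspose_mul_self R)
  have hPs : P.PosSemidef := sqrt_posSemidef _
  refine ⟨P * R⁻¹, ?_, ?_⟩
  · rw [Matrix.mem_unitaryGroup_iff', Matrix.star_eq_conjTranspose, Matrix.conjTranspose_mul,
      hPs.1.eq, Matrix.mul_assoc, ← Matrix.mul_assoc P, hPP, Matrix.mul_assoc,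
      Matrix.mul_nonsing_inv _ hR, Matrix.mul_one, ← Matrix.conjTranspose_mul,
      Matrix.mul_nonsing_inv _ hR, Matrix.conjTranspose_one]
  · rwa [Matrix.mul_assoc, Matrix.nonsing_inv_mul _ hR, Matrix.mul_one]

/-- Polar decomposition with a unitary factor. -/
theorem exists_unitary_mul_posSemidef (R : Matrix n n ℂ) :
    ∃ U ∈ Matrix.unitaryGroup n ℂ, (U * R).PosSemidef := by
  -- A singular `R` is perturbed to `R + t • 1`, invertible for small `t ≠ 0`. By compactness the
  -- unitary factors converge along an ultrafilter, and positivity is a closed condition.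
  have hev : ∀ᶠ t : ℂ in 𝓝[≠] 0, IsUnit (R + t • 1).det := by
    have hfin : (spectrum ℂ (-R)).Finite := Matrix.finite_spectrum (-R)
    have h0 : (spectrum ℂ (-R) \ {0})ᶜ ∈ 𝓝[≠] (0 : ℂ) :=
      mem_nhdsWithin_of_mem_nhds (hfin.sdiff.isClosed.isOpen_compl.mem_nhds (by simp))
    filter_upwards [h0, self_mem_nhdsWithin] with t ht' ht0
    have ht : t ∉ spectrum ℂ (-R) := fun hs => ht' ⟨hs, ht0⟩
    rw [spectrum.notMem_iff, Algebra.algebraMap_eq_smul_one, sub_neg_eq_add, add_comm] at ht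
    exact (Matrix.isUnit_iff_isUnit_det _).1 ht
  have hex : ∀ t : ℂ, ∃ U ∈ Matrix.unitaryGroup n ℂ,
      IsUnit (R + t • 1).det → (U * (R + t • 1)).PosSemidef := by
    intro t
    by_cases h : IsUnit (R + t • 1).det
    · obtain ⟨U, hU, h'⟩ := exists_unitary_mul_posSemidef_of_isUnit h
      exact ⟨U, hU, fun _ => h'⟩
    · exact ⟨1, one_mem _, fun h' => absurd h' h⟩
  choose U hU hpos using hex
  let l : Ultrafilter ℂ := Ultrafilter.of (𝓝[≠] 0)
  have hl : (l : Filter ℂ) ≤ 𝓝[≠] 0 := Ultrafilter.of_le _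
  obtain ⟨V, hV, hlim⟩ := isCompact_unitaryGroup.ultrafilter_le_nhds (l.map U)
    (le_principal_iff.2 (Ultrafilter.mem_map.2 (univ_mem' hU)))
  have hUV : Tendsto U l (𝓝 V) := hlim
  have ht : Tendsto (fun t : ℂ => t) l (𝓝 0) := hl.trans nhdsWithin_le_nhds
  have hRt : Tendsto (fun t : ℂ => R + t • (1 : Matrix n n ℂ)) l (𝓝 R) := by
    simpa using tendsto_const_nhds.add (ht.smul_const (1 : Matrix n n ℂ))
  refine ⟨V, hV, isClosed_setOf_posSemidef.mem_of_tendsto (hUV.mul hRt) ?_⟩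
  filter_upwards [hl hev] with t h using hpos t h

end Polar

/-- The vector of a matrix and two further real coordinates; the squared norm is
`tr (Xᴴ X) + a² + b²`. -/
def hsVec (X : Matrix n n ℂ) (a b : ℝ) : EuclideanSpace ℂ ((n × n) ⊕ Fin 2) :=
  WithLp.toLp 2 (Sum.elim (fun p => X p.1 p.2) ![(a : ℂ), (b : ℂ)])

omit [DecidableEq n] in
theorem inner_hsVec (X Y : Matrix n n ℂ) (a b c d : ℝ) :
    inner ℝ (hsVec X a b) (hsVec Y c d) = (X.conjTranspose * Y).trace.re + a * c + b * d := by
  simp [hsVec, PiLp.inner_apply, Matrix.trace, Matrix.mul_apply, Fintype.sum_prod_type]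
  rw [Finset.sum_comm]
  simp [add_assoc, mul_comm]

omit [DecidableEq n] in
theorem norm_hsVec_sq (X : Matrix n n ℂ) (a b : ℝ) :
    ‖hsVec X a b‖ ^ 2 = (X.conjTranspose * X).trace.re + a * a + b * b := by
  rw [← inner_hsVec, real_inner_self_eq_norm_sq]

/-! ### Trace norm as a maximum over unitaries. -/

section TraceNorm

/-- Cauchy–Schwarz for `√P` and `√P V`, both of squared Hilbert–Schmidt norm `tr P`. -/
theorem PosSemidef.abs_re_trace_mul_le {P V : Matrix n n ℂ} (hP : P.PosSemidef)
    (hV : V ∈ Matrix.unitaryGroup n ℂ) : |(P * V).trace.re| ≤ P.trace.re := by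
  set S := CFC.sqrt P
  have hS : S.conjTranspose = S := (sqrt_posSemidef P).1
  have hSS : S * S = P := sqrt_mul_sqrt hP
  have hx : ‖hsVec S 0 0‖ ^ 2 = P.trace.re := by simp [norm_hsVec_sq, hS, hSS]
  have hy : ‖hsVec (S * V) 0 0‖ ^ 2 = P.trace.re := by
    rw [norm_hsVec_sq, Matrix.trace_mul_comm, Matrix.conjTranspose_mul, Matrix.mul_assoc,
      ← Matrix.mul_assoc V, ← Matrix.star_eq_conjTranspose V, Matrix.mem_unitaryGroup_iff.1 hV,
      Matrix.one_mul, hS, hSS]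
    simp
  have hxy : ‖hsVec S 0 0‖ = ‖hsVec (S * V) 0 0‖ :=
    (sq_eq_sq₀ (norm_nonneg _) (norm_nonneg _)).1 (hx.trans hy.symm)
  have h := abs_real_inner_le_norm (hsVec S 0 0) (hsVec (S * V) 0 0)
  rw [inner_hsVec, ← hxy, ← sq (‖_‖), hx, hS, ← Matrix.mul_assoc, hSS] at h
  simpa using h

theorem exists_unitary_traceNorm_eq (R : Matrix n n ℂ) :
    ∃ U ∈ Matrix.unitaryGroup n ℂ, (U * R).PosSemidef ∧ traceNorm R = (U * R).trace.re := by
  obtain ⟨U, hU, hpos⟩ := exists_unitary_mul_posSemidef R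
  refine ⟨U, hU, hpos, ?_⟩
  have : CFC.sqrt (R.conjTranspose * R) = U * R := by
    refine CFC.sqrt_unique ?_ (Matrix.nonneg_iff_posSemidef.2 hpos)
    nth_rewrite 1 [← hpos.1.eq]
    rw [Matrix.conjTranspose_mul, Matrix.mul_assoc, ← Matrix.mul_assoc _ U,
      ← Matrix.star_eq_conjTranspose U, Matrix.mem_unitaryGroup_iff'.1 hU, Matrix.one_mul]
  rw [traceNorm, this]

theorem abs_re_trace_mul_le_traceNorm (R : Matrix n n ℂ) {V : Matrix n n ℂ}
    (hV : V ∈ Matrix.unitaryGroup n ℂ) : |(V * R).trace.re| ≤ traceNorm R := by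
  obtain ⟨U, hU, hpos, heq⟩ := exists_unitary_traceNorm_eq R
  have h := PosSemidef.abs_re_trace_mul_le hpos (mul_mem hV (Unitary.star_mem hU))
  rwa [Matrix.trace_mul_comm, Matrix.mul_assoc, ← Matrix.mul_assoc (star U),
    Matrix.mem_unitaryGroup_iff'.1 hU, Matrix.one_mul, ← heq] at h

theorem traceNorm_nonneg (R : Matrix n n ℂ) : 0 ≤ traceNorm R :=
  (Complex.nonneg_iff.1 (sqrt_posSemidef _).trace_nonneg).1

theorem traceNorm_le_conjTranspose (R : Matrix n n ℂ) :
    traceNorm R ≤ traceNorm R.conjTranspose := by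
  obtain ⟨U, hU, -, heq⟩ := exists_unitary_traceNorm_eq R
  have h := abs_re_trace_mul_le_traceNorm R.conjTranspose (Unitary.star_mem hU)
  rw [Matrix.trace_mul_comm, Matrix.star_eq_conjTranspose, ← Matrix.conjTranspose_mul,
    Matrix.trace_conjTranspose, Complex.star_def, Complex.conj_re, ← heq] at h
  exact (le_abs_self _).trans h

theorem traceNorm_conjTranspose (R : Matrix n n ℂ) :
    traceNorm R.conjTranspose = traceNorm R :=
  le_antisymm (by simpa using traceNorm_le_conjTranspose R.conjTranspose)
    (traceNorm_le_conjTranspose R)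

end TraceNorm

/-! ### Fidelity and purified distance. -/

section Fidelity

theorem fidelity_nonneg (ρ σ : Matrix n n ℂ) : 0 ≤ fidelity ρ σ := traceNorm_nonneg _

/-- Here `σ` enters linearly under a single root, so monotonicity and scaling in `σ` follow from
those of the operator square root. -/
theorem fidelity_eq_trace_sqrt (ρ : Matrix n n ℂ) {σ : Matrix n n ℂ} (hσ : σ.PosSemidef) :
    fidelity ρ σ = (CFC.sqrt (CFC.sqrt ρ * σ * CFC.sqrt ρ)).trace.re := by
  rw [fidelity, ← traceNorm_conjTranspose, traceNorm, Matrix.conjTranspose_conjTranspose,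
    Matrix.conjTranspose_mul, (sqrt_posSemidef ρ).1.eq, (sqrt_posSemidef σ).1.eq,
    Matrix.mul_assoc, ← Matrix.mul_assoc (CFC.sqrt σ), sqrt_mul_sqrt hσ, ← Matrix.mul_assoc]

theorem fidelity_mono (ρ : Matrix n n ℂ) {σ σ' : Matrix n n ℂ} (hσ : σ.PosSemidef)
    (hσ' : σ'.PosSemidef) (hle : (σ' - σ).PosSemidef) : fidelity ρ σ ≤ fidelity ρ σ' := by
  rw [fidelity_eq_trace_sqrt ρ hσ, fidelity_eq_trace_sqrt ρ hσ']
  have h1 : CFC.sqrt ρ * σ * CFC.sqrt ρ ≤ CFC.sqrt ρ * σ' * CFC.sqrt ρ := by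
    rw [Matrix.le_iff]
    have := hle.conjTranspose_mul_mul_same (CFC.sqrt ρ)
    rwa [(sqrt_posSemidef ρ).1.eq, Matrix.mul_sub, Matrix.sub_mul] at this
  have h2 := (Matrix.le_iff.1 (sqrt_monotone h1)).trace_nonneg
  rw [Matrix.trace_sub] at h2
  simpa using (Complex.nonneg_iff.1 h2).1

theorem sqrt_smul {c : ℝ} (hc : 0 ≤ c) {X : Matrix n n ℂ} (hX : X.PosSemidef) :
    CFC.sqrt ((c : ℂ) • X) = ((√c : ℝ) : ℂ) • CFC.sqrt X := by
  refine CFC.sqrt_unique ?_ (Matrix.nonneg_iff_posSemidef.2 ((sqrt_posSemidef X).smul ?_))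
  · rw [smul_mul_smul_comm, sqrt_mul_sqrt hX, ← Complex.ofReal_mul, Real.mul_self_sqrt hc]
  · exact_mod_cast Real.sqrt_nonneg c

theorem fidelity_smul_sq {c : ℝ} (hc : 0 ≤ c) (ρ : Matrix n n ℂ) {σ : Matrix n n ℂ}
    (hσ : σ.PosSemidef) : fidelity ρ ((c : ℂ) • σ) ^ 2 = c * fidelity ρ σ ^ 2 := by
  have hc' : (0 : ℂ) ≤ (c : ℂ) := by exact_mod_cast hc
  rw [fidelity_eq_trace_sqrt ρ (hσ.smul hc'), fidelity_eq_trace_sqrt ρ hσ, Matrix.mul_smul,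
    Matrix.smul_mul, sqrt_smul hc, Matrix.trace_smul, smul_eq_mul, Complex.re_ofReal_mul, mul_pow,
    Real.sq_sqrt hc]
  simpa [(sqrt_posSemidef ρ).1.eq] using hσ.conjTranspose_mul_mul_same (CFC.sqrt ρ)

theorem IsSubnormalized.norm_hsVec_sqrt_mul {ρ U : Matrix n n ℂ} (hρ : IsSubnormalized ρ)
    (hU : U ∈ Matrix.unitaryGroup n ℂ) {a b : ℝ} (hab : a * a + b * b = 1 - ρ.trace.re) :
    ‖hsVec (CFC.sqrt ρ * U) a b‖ = 1 := by
  rw [← sq_eq_sq₀ (norm_nonneg _) zero_le_one, norm_hsVec_sq, Matrix.trace_mul_comm,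
    Matrix.conjTranspose_mul, Matrix.mul_assoc, ← Matrix.mul_assoc U,
    ← Matrix.star_eq_conjTranspose U, Matrix.mem_unitaryGroup_iff.1 hU, Matrix.one_mul,
    (sqrt_posSemidef ρ).1.eq, sqrt_mul_sqrt hρ.1]
  linarith

/-- Smoothing two sub-normalized states around `ρ` keeps their fidelity close to one. -/
theorem sqrt_one_sub_fidelity_sq_le {ρ τ τ' : Matrix n n ℂ} (hρ : IsSubnormalized ρ)
    (hτ : IsSubnormalized τ) (hτ' : IsSubnormalized τ') :
    √(1 - fidelity τ τ' ^ 2) ≤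
      purifiedDist τ ρ + purifiedDist τ' ρ + 2 * √(1 - ρ.trace.re) := by
  obtain ⟨U, hU, -, hFU⟩ := exists_unitary_traceNorm_eq (CFC.sqrt τ * CFC.sqrt ρ)
  obtain ⟨V, hV, -, hFV⟩ := exists_unitary_traceNorm_eq (CFC.sqrt τ' * CFC.sqrt ρ)
  have hsa (X : Matrix n n ℂ) : (CFC.sqrt X).conjTranspose = CFC.sqrt X := (sqrt_posSemidef X).1
  have hVU : star V * U ∈ Matrix.unitaryGroup n ℂ := mul_mem (Unitary.star_mem hV) hU
  have sτ : 0 ≤ 1 - τ.trace.re := sub_nonneg.2 hτ.2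
  have sτ' : 0 ≤ 1 - τ'.trace.re := sub_nonneg.2 hτ'.2
  have sρ : 0 ≤ 1 - ρ.trace.re := sub_nonneg.2 hρ.2
  have htρ : 0 ≤ ρ.trace.re := (Complex.nonneg_iff.1 hρ.1.trace_nonneg).1
  -- `U` makes the overlap of `x` and `y` optimal; the factor `star V * U` does so for `z` and `w`.
  -- The spare coordinates of `x` and `w` are orthogonal.
  set x := hsVec (CFC.sqrt τ) (√(1 - τ.trace.re)) 0 with hx
  set y := hsVec (CFC.sqrt ρ * U) (√(1 - ρ.trace.re)) 0 with hy
  set z := hsVec (CFC.sqrt ρ * U) 0 (√(1 - ρ.trace.re)) with hz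
  set w := hsVec (CFC.sqrt τ' * (star V * U)) 0 (√(1 - τ'.trace.re)) with hw
  have nx : ‖x‖ = 1 := by
    have := hτ.norm_hsVec_sqrt_mul (one_mem _) (a := √(1 - τ.trace.re)) (b := 0)
      (by simp [Real.mul_self_sqrt sτ])
    rwa [Matrix.mul_one] at this
  have ny : ‖y‖ = 1 := hρ.norm_hsVec_sqrt_mul hU (by simp [Real.mul_self_sqrt sρ])
  have nz : ‖z‖ = 1 := hρ.norm_hsVec_sqrt_mul hU (by simp [Real.mul_self_sqrt sρ])
  have nw : ‖w‖ = 1 := hτ'.norm_hsVec_sqrt_mul hVU (by simp [Real.mul_self_sqrt sτ'])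
  have ixy : inner ℝ x y = genFidelity τ ρ := by
    rw [hx, hy, inner_hsVec, hsa, ← Matrix.mul_assoc, Matrix.trace_mul_comm, ← hFU, genFidelity,
      fidelity, Real.sqrt_mul sτ, mul_zero, add_zero]
  have iyz : inner ℝ y z = ρ.trace.re := by
    rw [hy, hz, inner_hsVec, Matrix.trace_mul_comm, Matrix.conjTranspose_mul, Matrix.mul_assoc,
      ← Matrix.mul_assoc U, ← Matrix.star_eq_conjTranspose U, Matrix.mem_unitaryGroup_iff.1 hU,
      Matrix.one_mul, hsa, sqrt_mul_sqrt hρ.1]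
    ring
  have izw : inner ℝ z w = genFidelity τ' ρ := by
    rw [real_inner_comm, hz, hw, inner_hsVec, ← Matrix.mul_assoc, Matrix.trace_mul_comm,
      Matrix.conjTranspose_mul, Matrix.conjTranspose_mul, Matrix.mul_assoc, Matrix.mul_assoc,
      ← Matrix.mul_assoc U, ← Matrix.star_eq_conjTranspose U, Matrix.mem_unitaryGroup_iff.1 hU,
      Matrix.one_mul, Matrix.star_eq_conjTranspose, Matrix.conjTranspose_conjTranspose, hsa,
      ← hFV, genFidelity, fidelity, Real.sqrt_mul sτ']
    ring
  have ixw : |inner ℝ x w| ≤ fidelity τ τ' := by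
    rw [hx, hw, inner_hsVec, hsa, ← Matrix.mul_assoc, Matrix.trace_mul_comm, mul_zero, zero_mul,
      add_zero, add_zero]
    exact abs_re_trace_mul_le_traceNorm _ hVU
  have h1 := sqrt_one_sub_inner_sq_triangle nx ny nw
  have h2 := sqrt_one_sub_inner_sq_triangle ny nz nw
  rw [ixy] at h1
  rw [iyz, izw] at h2
  -- With `t = tr ρ ≤ 1`, `1 - t² = (1 - t)(1 + t) ≤ 4 (1 - t)`.
  have h3 : √(1 - ρ.trace.re ^ 2) ≤ 2 * √(1 - ρ.trace.re) := by
    refine Real.sqrt_le_iff.2 ⟨by positivity, ?_⟩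
    rw [mul_pow, Real.sq_sqrt sρ]
    nlinarith
  have h4 : √(1 - fidelity τ τ' ^ 2) ≤ √(1 - inner ℝ x w ^ 2) := by
    apply Real.sqrt_le_sqrt
    have := pow_le_pow_left₀ (abs_nonneg _) ixw 2
    rw [sq_abs] at this
    linarith
  rw [purifiedDist, purifiedDist]
  linarith

end Fidelity

/-! ### Comparison of min- and max-entropy. -/

section Entropy

theorem coe_add_logb_fidelity_sq_le_maxEntropy {τ τ' : Matrix (A × B) (A × B) ℂ}
    {σ : Matrix B B ℂ} {l : ℝ} (hσ : IsSubnormalized σ) (hτ' : τ'.PosSemidef)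
    (hF : 0 < fidelity τ τ' ^ 2)
    (hle : ((((2 : ℝ) ^ (-l) : ℝ) : ℂ) • ((1 : Matrix A A ℂ) ⊗ₖ σ) - τ').PosSemidef) :
    ((l + Real.logb 2 (fidelity τ τ' ^ 2) : ℝ) : EReal) ≤ maxEntropy τ := by
  have hk : ((1 : Matrix A A ℂ) ⊗ₖ σ).PosSemidef := Matrix.PosSemidef.one.kronecker hσ.1
  have hc : (0 : ℝ) < 2 ^ (-l) := Real.rpow_pos_of_pos two_pos _
  have hmono := fidelity_mono τ hτ' (hk.smul (by exact_mod_cast hc.le)) hle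
  have hsq := pow_le_pow_left₀ (fidelity_nonneg _ _) hmono 2
  rw [fidelity_smul_sq hc.le τ hk] at hsq
  set G := fidelity τ ((1 : Matrix A A ℂ) ⊗ₖ σ) ^ 2 with hG
  have hGpos : 0 < G := pos_of_mul_pos_right (hF.trans_le hsq) hc.le
  have hlog : l + Real.logb 2 (fidelity τ τ' ^ 2) ≤ Real.logb 2 G := by
    have := Real.logb_le_logb_of_le one_lt_two hF hsq
    rw [Real.logb_mul hc.ne' hGpos.ne', Real.logb_rpow two_pos (by norm_num)] at this
    linarith
  refine le_trans ?_ (le_iSup₂_of_le (f := fun σ _ => maxEntropyRel τ σ) σ hσ le_rfl)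
  rw [maxEntropyRel, ← hG, elog2, if_neg hGpos.not_ge]
  exact_mod_cast hlog

theorem minEntropy_le_maxEntropy_add {ρ τ τ' : Matrix (A × B) (A × B) ℂ} {δ : ℝ}
    (hρ : IsSubnormalized ρ) (hτ : IsSubnormalized τ) (hτ' : IsSubnormalized τ')
    (hdist : purifiedDist τ ρ + purifiedDist τ' ρ + 2 * √(1 - ρ.trace.re) ≤ δ) (hδ : δ < 1) :
    minEntropy τ' ≤ maxEntropy τ + ((Real.logb 2 (1 / (1 - δ ^ 2)) : ℝ) : EReal) := by
  have hδF := (sqrt_one_sub_fidelity_sq_le hρ hτ hτ').trans hdist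
  have hδ0 : 0 ≤ δ := (Real.sqrt_nonneg _).trans hδF
  have hδ2 : 0 < 1 - δ ^ 2 := by nlinarith
  have hF : 1 - δ ^ 2 ≤ fidelity τ τ' ^ 2 := by
    have := (Real.sqrt_le_left hδ0).1 hδF
    linarith
  refine iSup₂_le fun σ hσ => iSup₂_le fun l hl => ?_
  have h := coe_add_logb_fidelity_sq_le_maxEntropy hσ hτ'.1 (hδ2.trans_le hF) hl
  have hlog := Real.logb_le_logb_of_le one_lt_two hδ2 hF
  rw [one_div, Real.logb_inv]
  calc (l : EReal)
      ≤ ((l + Real.logb 2 (fidelity τ τ' ^ 2) + -Real.logb 2 (1 - δ ^ 2) : ℝ) : EReal) := by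
        exact_mod_cast (by linarith)
    _ ≤ _ := by
        rw [EReal.coe_add]
        gcongr

end Entropy

end SmoothEntropy

end

theorem mainTheorem5 {A B : Type*} [Fintype A] [DecidableEq A] [Fintype B] [DecidableEq B]
    (ε ε' : ℝ) (hε : 0 ≤ ε) (hε' : 0 ≤ ε')
    (ρ : Matrix (A × B) (A × B) ℂ) (hρ : SmoothEntropy.IsSubnormalized ρ)
    (h : ε + ε' + 2 * √(1 - ρ.trace.re) < 1) :
    SmoothEntropy.smoothMinEntropy ε' ρ ≤
      SmoothEntropy.smoothMaxEntropy ε ρ +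
        ((Real.logb 2 (1 / (1 - (ε + ε' + 2 * √(1 - ρ.trace.re)) ^ 2)) : ℝ) : EReal) := by
  refine iSup₂_le fun τ' hτ' => ?_
  -- The finite constant is moved to the left so that the infimum over `τ` stands alone.
  rw [← EReal.sub_le_iff_le_add (by simp) (by simp)]
  refine le_iInf₂ fun τ hτ => ?_
  rw [EReal.sub_le_iff_le_add (by simp) (by simp)]
  refine SmoothEntropy.minEntropy_le_maxEntropy_add hρ hτ.1 hτ'.1 ?_ h
  linarith [hτ.2, hτ'.2]
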